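/- Let $k$ be a field, let $M$ be a lattice (a finitely generated free abelian group), and let $T=\operatorname{Spec}k[M]$ be the split torus with character lattice $M$. Let $Z$ be a toric variety over $k$ with dense torus $T_Z=T$: an integral separated $k$-scheme of finite type with an action of $T$ and an open immersion $e\colon T\hookrightarrow Z$ such that the action on $Z$ extends the action of $T$ on itself. Let $X$ be an arbitrary scheme over $k$. All products are over $k$ unless indicated otherwise. A principal $T$-bundle $\pi\colon P\to X$ is an $X$-scheme with a fibrewise action of $T$ that is Zariski-locally on $X$ equivariantly isomorphic to $X\times T$. A toric variety bundle over $X$ with fibre $Z$ is a diagram of $X$-schemes $\iota\colon P\to Y$, with $\pi\colon P\to X$ a principal $T$-bundle and $\rho\colon Y\to X$ a morphism, such that Zariski-locally on $X$ there are an equivariant isomorphism $P\cong X\times T$ over $X$ and an isomorphism $Y\cong X\times Z$ over $X$ that identify $\iota$ with the inclusion $\operatorname{id}\times e\colon X\times T\hookrightarrow X\times Z$. Given a principal $T$-bundle $\pi\colon P\to X$, a mixing bundle $(P\times Z)/T$ is an $X$-scheme $\rho\colon Y\to X$ with a morphism $q\colon P\times Z\to Y$ over $X$ (where $P\times Z\to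 X$ is the projection to $P$ followed by $\pi$) which is the quotient by the diagonal action $t\cdot(p,z)=(p\cdot t^{-1},t\cdot z)$, that is, a principal $T$-bundle for this action. Here $p\cdot t^{-1}=t^{-1}\cdot p$, as $T$ is commutative. Call $\iota\colon P\to Y$ and $q\colon P\times Z\to Y$ compatible if $q(p,e(t))=\iota(t\cdot p)$ for all points $p$ of $P$ and $t$ of $T$ with values in any $k$-scheme; this is the identification $P=(P\times T)/T\subseteq(P\times Z)/T$. Toric variety bundles and mixing bundles are equivalent notions. Precisely: 1. For every principal $T$-bundle $P\to X$ the mixing bundle $(P\times Z)/T$ exists as a scheme over $X$. 2. The mixing construction produces a toric variety bundle: if $P\to X$ is a principal $T$-bundle and $q\colon P\times Z\to Y$ exhibits the $X$-scheme $Y$ as the mixing bundle $(P\times Z)/T$, then there is a unique morphism $\iota\colon P\to Y$ compatible with $q$ for which $P\to Y\to X$ is a toric variety bundle with fibre $Z$. 3. Every toric variety bundle arises from the mixing construction: if $\iota\colon P\to Y$ is a toric variety bundle over $X$ with fibre $Z$, then there is a unique morphism $q\colon P\times Z\to Y$ compatible with $\iota$ that exhibits $Y$ as the mixing bundle $(P\times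 Z)/T$. 4. The transition functions of a toric variety bundle factor through $T\le\operatorname{Aut}(Z)$: let $U,V\subseteq X$ be open and let $(\varphi_U,\psi_U)$ and $(\varphi_V,\psi_V)$ be trivialisations over $U$ and $V$ of a toric variety bundle $P\to Y\to X$, where $\varphi_U\colon P|_U\cong U\times T$ is equivariant, $\psi_U\colon Y|_U\cong U\times Z$, the two identify $P|_U\to Y|_U$ with $U\times T\hookrightarrow U\times Z$, and similarly for $V$. Then there is a morphism $g\colon U\cap V\to T$ such that over $U\cap V$ $$\varphi_U\circ\varphi_V^{-1}(x,t)=(x,g(x)\,t),\qquad \psi_U\circ\psi_V^{-1}(x,z)=(x,g(x)\cdot z),$$ and $g$ is the only morphism $U\cap V\to T$ for which the second equation holds. -/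

import Mathlib

universe u

open CategoryTheory Limits MonoidalCategory CartesianMonoidalCategory AlgebraicGeometry
open scoped MonObj

namespace ToricBundle

/-- Schemes over the field `k`. Products `⊗` in this category are fibre products over `Spec k`. -/
abbrev SchemeOver (k : Type u) [Field k] : Type (u + 1) :=
  Over (Spec (CommRingCat.of k))

section Torus

variable (k : Type u) [Field k] (M : Type u) [AddCommGroup M]

/-- The split torus `Spec k[M]` with character lattice `M`. -/
noncomputable def torus : SchemeOver k :=
  (Spec (CommRingCat.of (AddMonoidAlgebra k M))).asOver (Spec (CommRingCat.of k))

/-- The group scheme structure on `Spec k[M]`: the comultiplication of `k[M]` sends the character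
`χ^m` to `χ^m ⊗ χ^m`. -/
noncomputable instance : CommGrpObj (torus k M) :=
  inferInstanceAs <| CommGrpObj
    ((Spec (CommRingCat.of (AddMonoidAlgebra k M))).asOver (Spec (CommRingCat.of k)))

/-- A toric variety over `k` whose dense torus is the split torus with character lattice `M`:
an integral separated scheme of finite type over `k` with an action of the torus, containing
the torus as an open subscheme in such a way that the action extends the action of the torus on
itself. (The torus is automatically dense, since the variety is irreducible.) -/
structure ToricVariety where
  /-- the variety -/
  carrier : SchemeOver k
  isIntegral : IsIntegral carrier.left
  isSeparated : IsSeparated carrier.hom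
  locallyOfFiniteType : LocallyOfFiniteType carrier.hom
  quasiCompact : QuasiCompact carrier.hom
  /-- the action of the torus on the variety -/
  action : ModObj (torus k M) carrier
  /-- the inclusion of the torus -/
  emb : torus k M ⟶ carrier
  isOpenImmersion : IsOpenImmersion emb.left
  emb_mul : ∀ {W : SchemeOver k} (s t : W ⟶ torus k M), (s * t) ≫ emb = s • (t ≫ emb)

attribute [instance] ToricVariety.action

end Torus

variable {k : Type u} [Field k]

/-- An open subset of a `k`-scheme, as a `k`-scheme. -/
noncomputable def openSub (X : SchemeOver k) (U : X.left.Opens) : SchemeOver k :=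
  Over.mk (U.ι ≫ X.hom)

/-- The inclusion of an open subscheme. -/
noncomputable def openIncl (X : SchemeOver k) (U : X.left.Opens) : openSub X U ⟶ X :=
  Over.homMk U.ι

/-- The inclusion of a smaller open subscheme into a larger one. -/
noncomputable def openMono (X : SchemeOver k) {U V : X.left.Opens} (h : U ≤ V) :
    openSub X U ⟶ openSub X V :=
  Over.homMk (X.left.homOfLE h) (by simp [openSub])

section Bundle

variable {M : Type u} [AddCommGroup M]

/-- `φ : U × T ⟶ P` is a trivialisation over `U ⊆ X` of the `T`-scheme `π : P ⟶ X`, where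
`T = torus k M`: it is equivariant, and it identifies `U × T` with `P|_U = P ×_X U` over `U`. -/
structure IsTorusTrivialization {X P : SchemeOver k} [ModObj (torus k M) P] (π : P ⟶ X)
    (U : X.left.Opens) (φ : openSub X U ⊗ torus k M ⟶ P) : Prop where
  isPullback : IsPullback φ (fst (openSub X U) (torus k M)) π (openIncl X U)
  equivariant : ∀ {W : SchemeOver k} (u : W ⟶ openSub X U) (s t : W ⟶ torus k M),
    lift u (s * t) ≫ φ = s • (lift u t ≫ φ)

variable (M) in
/-- `π : P ⟶ X` is a (Zariski-locally trivial) principal bundle under the torus with character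
lattice `M`. -/
structure IsPrincipalBundle {X P : SchemeOver k} [ModObj (torus k M) P] (π : P ⟶ X) :
    Prop where
  invariant : ∀ {W : SchemeOver k} (t : W ⟶ torus k M) (p : W ⟶ P), (t • p) ≫ π = p ≫ π
  locally_trivial : ∀ x : X.left, ∃ U : X.left.Opens, x ∈ U ∧
    ∃ φ : openSub X U ⊗ torus k M ⟶ P, IsTorusTrivialization π U φ

/-- A trivialisation over `U ⊆ X` of the diagram `i : P ⟶ Y` over `X`, for `π : P ⟶ X` and
`ρ : Y ⟶ X`: compatible identifications of `P|_U` with `U × T` (equivariantly) and of `Y|_U` with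
`U × Z`, over `U`, under which `i` becomes the inclusion `U × T ⊆ U × Z`. -/
structure IsBundleTrivialization (Z : ToricVariety k M) {X P Y : SchemeOver k}
    [ModObj (torus k M) P] (π : P ⟶ X) (ρ : Y ⟶ X) (i : P ⟶ Y) (U : X.left.Opens)
    (φ : openSub X U ⊗ torus k M ⟶ P) (ψ : openSub X U ⊗ Z.carrier ⟶ Y) : Prop where
  torus_part : IsTorusTrivialization π U φ
  isPullback : IsPullback ψ (fst (openSub X U) Z.carrier) ρ (openIncl X U)
  compatible : φ ≫ i = (openSub X U ◁ Z.emb) ≫ ψ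

/-- The diagram `P ⟶ Y` over `X` is a toric variety bundle with fibre `Z`: `P` is a principal
bundle, and Zariski-locally on `X` the diagram is `X × T ⊆ X × Z`. -/
structure IsToricVarietyBundle (Z : ToricVariety k M) {X P Y : SchemeOver k}
    [ModObj (torus k M) P] (π : P ⟶ X) (ρ : Y ⟶ X) (i : P ⟶ Y) : Prop where
  principal : IsPrincipalBundle M π
  over_base : i ≫ ρ = π
  locally_trivial : ∀ x : X.left, ∃ U : X.left.Opens, x ∈ U ∧
    ∃ (φ : openSub X U ⊗ torus k M ⟶ P) (ψ : openSub X U ⊗ Z.carrier ⟶ Y),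
      IsBundleTrivialization Z π ρ i U φ ψ

/-- The formula `(p • t⁻¹, t • z)` evaluated at `t • (p, z) : W ⟶ T × (P × Z)`. -/
lemma comp_mixingFormula {P Z W : SchemeOver k} [ModObj (torus k M) P] [ModObj (torus k M) Z]
    (f : W ⟶ torus k M ⊗ (P ⊗ Z)) :
    f ≫ lift
        ((fst (torus k M) (P ⊗ Z))⁻¹ • (snd (torus k M) (P ⊗ Z) ≫ fst P Z))
        (fst (torus k M) (P ⊗ Z) • (snd (torus k M) (P ⊗ Z) ≫ snd P Z)) =
      lift ((f ≫ fst _ _)⁻¹ • (f ≫ snd _ _ ≫ fst _ _)) ((f ≫ fst _ _) • (f ≫ snd _ _ ≫ snd _ _)) := by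
  rw [comp_lift, ModObj.comp_smul, ModObj.comp_smul, GrpObj.comp_inv]

/-- The diagonal action of the torus on `P × Z`, in terms of points
`t • (p, z) = (p • t⁻¹, t • z)`: the right action of the torus on the principal bundle `P` is
made into a left action by inversion. -/
@[reducible] noncomputable def mixingAction (P Z : SchemeOver k) [ModObj (torus k M) P]
    [ModObj (torus k M) Z] : ModObj (torus k M) (P ⊗ Z) where
  smul := lift
    ((fst (torus k M) (P ⊗ Z))⁻¹ • (snd (torus k M) (P ⊗ Z) ≫ fst P Z))
    (fst (torus k M) (P ⊗ Z) • (snd (torus k M) (P ⊗ Z) ≫ snd P Z))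
  one_smul := by
    change η ▷ (P ⊗ Z) ≫ _ = (λ_ _).hom
    have h : η ▷ (P ⊗ Z) ≫ fst (torus k M) (P ⊗ Z) = 1 := by
      rw [whiskerRight_fst, Hom.one_def]
      congr 1
    rw [comp_mixingFormula, h, inv_one, one_smul, one_smul, ← comp_lift, ← comp_lift,
      lift_fst_snd, Category.comp_id, whiskerRight_snd, leftUnitor_hom]
  mul_smul := by
    change μ ▷ (P ⊗ Z) ≫ _ = (α_ _ _ _).hom ≫ _ ◁ _ ≫ _
    have h : μ ▷ (P ⊗ Z) ≫ fst (torus k M) (P ⊗ Z) =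
        (fst _ _ ≫ fst _ _) * (fst _ _ ≫ snd _ _) := by
      rw [whiskerRight_fst, Hom.mul_def, ← comp_lift, lift_fst_snd, Category.comp_id]
    rw [comp_mixingFormula, h, ← Category.assoc, comp_mixingFormula]
    simp only [comp_lift, MonObj.comp_mul, Category.assoc, whiskerLeft_fst,
      whiskerLeft_snd_assoc, associator_hom_fst, lift_fst, lift_snd, ModObj.comp_smul,
      GrpObj.comp_inv, associator_hom_snd_snd_assoc, associator_hom_snd_fst,
      whiskerRight_snd_assoc, smul_smul, mul_inv]

/-- `q : P × Z ⟶ Y` exhibits the scheme `ρ : Y ⟶ X` as the mixing bundle `(P × Z) / T` of the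
principal bundle `π : P ⟶ X` with the toric variety `Z`: the morphism `q` is compatible with the
projections to `X`, and it is the quotient by the free diagonal action, that is, a principal
bundle for this action. -/
structure IsMixingBundle (Z : ToricVariety k M) {X P Y : SchemeOver k}
    [ModObj (torus k M) P] (π : P ⟶ X) (ρ : Y ⟶ X) (q : P ⊗ Z.carrier ⟶ Y) : Prop where
  over_base : q ≫ ρ = fst P Z.carrier ≫ π
  quotient :
    letI : ModObj (torus k M) (P ⊗ Z.carrier) := mixingAction P Z.carrier
    IsPrincipalBundle M q

/-- The quotient map `q : P × Z ⟶ Y` and the inclusion `i : P ⟶ Y` correspond to each other under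
the identification `P = (P × T) / T ⊆ (P × Z) / T`: for points `p` of `P` and `t` of
`T ⊆ Z` one has `q (p, t) = i (t • p)`. -/
def IsCompatible (Z : ToricVariety k M) {P Y : SchemeOver k} [ModObj (torus k M) P]
    (i : P ⟶ Y) (q : P ⊗ Z.carrier ⟶ Y) : Prop :=
  ∀ {W : SchemeOver k} (p : W ⟶ P) (t : W ⟶ torus k M),
    lift p (t ≫ Z.emb) ≫ q = (t • p) ≫ i

/-- Two trivialisations `ψ : U × F ⟶ Y` and `ψ' : V × F ⟶ Y`, where the torus acts on `F`, differ
over `U ∩ V` by the action of `g : U ∩ V ⟶ T`: the transition function `ψ⁻¹ ∘ ψ'` is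
`(x, z) ↦ (x, g x • z)`. -/
def IsTransitionFunction {X F Y : SchemeOver k} [ModObj (torus k M) F] (U V : X.left.Opens)
    (ψ : openSub X U ⊗ F ⟶ Y) (ψ' : openSub X V ⊗ F ⟶ Y)
    (g : openSub X (U ⊓ V) ⟶ torus k M) : Prop :=
  ∀ {W : SchemeOver k} (x : W ⟶ openSub X (U ⊓ V)) (z : W ⟶ F),
    lift (x ≫ openMono X inf_le_left) ((x ≫ g) • z) ≫ ψ =
      lift (x ≫ openMono X inf_le_right) z ≫ ψ'

end Bundle

end ToricBundle

/-!
All objects are handled through their points with values in a `k`-scheme `W`, and morphisms are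
constructed by gluing: a relation between points which is stable under restriction, has unique
solutions and is locally solvable defines a morphism (`exists_glue`).

On points, a principal bundle is an invariant morphism with local sections such that the torus acts
simply transitively on the points of each fibre (`IsPrincipalBundle.exists_smul_eq`,
`IsPrincipalBundle.smul_injective`, `IsPrincipalBundle.of_simply_transitive`).

Given local sections `s i` of `P` and charts `ψ i : U i × Z ⟶ Y` whose transition functions
are the differences of the sections, the formula `(t • s i x, z) ↦ ψ i (x, t • z)` does not
depend on choices and exhibits `Y` as the mixing bundle (`exists_isMixingBundle`). Thus only such charts
are needed, both for the existence of the mixing bundle and for the passage from a toric variety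
bundle to a mixing bundle:

* Existence. The products `U × Z`, one for each section of `P` over an open subset `U` of `X`,
  are glued along the differences of the sections (`IsPrincipalBundle.mixing`). The cocycle
  condition holds because the difference of two sections is unique.
* Toric variety bundles. The morphism `U × T ⟶ U × Z` is scheme-theoretically dense for every
  `k`-scheme `U`, being a flat base change of the dominant morphism `T ⟶ Z` into an integral scheme,
  and `Z` is separated. Hence the transition functions on `Z`-charts are determined by those on the
  principal bundle, which are equivariant automorphisms of `U × T`, that is, translations by
  points of the torus (`IsBundleTrivialization.lift_comp_eq`). For the same reason the quotient map
  is determined by its restriction to `P × T` (`IsToricVarietyBundle.eq_of_isCompatible`).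

Conversely, in a mixing bundle `q : P × Z ⟶ Y` any point `p` of `P` identifies the fibre of `Y` with
`Z` by `z ↦ q (p, z)`, since the torus acts simply transitively both on the fibres of `P` and on
those of `q`. Local sections of `P` therefore give charts of `Y`, and `p ↦ q (p, 1)` is the inclusion
of `P` (`IsMixingBundle.existsUnique_isToricVarietyBundle`).
-/

namespace ToricBundle

variable {k : Type u} [Field k] {M : Type u} [AddCommGroup M]

/-! ### Gluing morphisms over a field -/

instance isOpenImmersion_openIncl (X : SchemeOver k) (U : X.left.Opens) :
    IsOpenImmersion (openIncl X U).left :=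
  inferInstanceAs (IsOpenImmersion U.ι)

lemma mono_of_isOpenImmersion {X Y : SchemeOver k} (f : X ⟶ Y) [IsOpenImmersion f.left] :
    Mono f :=
  (Over.forget _).mono_of_mono_map (inferInstanceAs (Mono f.left))

instance mono_openIncl (X : SchemeOver k) (U : X.left.Opens) : Mono (openIncl X U) :=
  mono_of_isOpenImmersion _

@[simp]
lemma openMono_openIncl (X : SchemeOver k) {U V : X.left.Opens} (h : U ≤ V) :
    openMono X h ≫ openIncl X V = openIncl X U := by
  ext1
  exact Scheme.homOfLE_ι _ h

lemma openMono_refl (X : SchemeOver k) (U : X.left.Opens) : openMono X (le_refl U) = 𝟙 _ := by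
  rw [← cancel_mono (openIncl X U), openMono_openIncl, Category.id_comp]

@[simp]
lemma openMono_openMono (X : SchemeOver k) {U V V' : X.left.Opens} (h : U ≤ V) (h' : V ≤ V') :
    openMono X h ≫ openMono X h' = openMono X (h.trans h') := by
  rw [← cancel_mono (openIncl X V'), Category.assoc, openMono_openIncl, openMono_openIncl,
    openMono_openIncl]

/-- A morphism factors through an open subscheme which contains its image. -/
lemma exists_comp_openIncl {W X : SchemeOver k} (f : W ⟶ X) (U : X.left.Opens)
    (h : ∀ w : W.left, f.left w ∈ U) : ∃ g : W ⟶ openSub X U, g ≫ openIncl X U = f := by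
  have h' : Set.range f.left ⊆ Set.range U.ι := by
    rintro _ ⟨w, rfl⟩
    simpa using h w
  have hw : IsOpenImmersion.lift U.ι f.left h' ≫ U.ι ≫ X.hom = W.hom := by
    rw [IsOpenImmersion.lift_fac_assoc, Over.w]
  have hf := IsOpenImmersion.lift_fac U.ι f.left h'
  let a := IsOpenImmersion.lift U.ι f.left h'
  refine ⟨Over.homMk (V := openSub X U) a (by exact hw), ?_⟩
  ext1
  exact hf

lemma comp_openIncl_mem {W X : SchemeOver k} {U : X.left.Opens} (g : W ⟶ openSub X U)
    (w : W.left) : (g ≫ openIncl X U).left w ∈ U :=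
  (g.left w).2

/-- The preimage of an open subset maps into it. -/
lemma exists_preimage_comp_openIncl {W X : SchemeOver k} (f : W ⟶ X) (U : X.left.Opens) :
    ∃ g : openSub W (f.left ⁻¹ᵁ U) ⟶ openSub X U,
      g ≫ openIncl X U = openIncl W (f.left ⁻¹ᵁ U) ≫ f :=
  exists_comp_openIncl _ _ fun w ↦ w.2

/-- Equality of morphisms may be checked locally on the source. -/
lemma hom_ext_local {W Y : SchemeOver k} (f g : W ⟶ Y)
    (h : ∀ w : W.left, ∃ U : W.left.Opens, w ∈ U ∧ openIncl W U ≫ f = openIncl W U ≫ g) :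
    f = g := by
  ext1
  refine Scheme.hom_ext_of_forall _ _ fun w ↦ ?_
  obtain ⟨U, hw, hU⟩ := h w
  exact ⟨U, hw, congr($(hU).left)⟩

/-- Morphisms into `Y` glue: if a relation `R` on pairs `(j : W' ⟶ W, f : W' ⟶ Y)` is stable under
restriction, has at most one solution `f` for each `j`, and locally on `W` has a solution, then
there is a morphism `W ⟶ Y` which restricts to every solution. -/
lemma exists_glue {W Y : SchemeOver k} (R : ∀ {W' : SchemeOver k}, (W' ⟶ W) → (W' ⟶ Y) → Prop)
    (restrict : ∀ {W' W'' : SchemeOver k} (a : W'' ⟶ W') (j : W' ⟶ W) (f : W' ⟶ Y),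
      R j f → R (a ≫ j) (a ≫ f))
    (unique : ∀ {W' : SchemeOver k} (j : W' ⟶ W) (f g : W' ⟶ Y), R j f → R j g → f = g)
    (exists_local : ∀ w : W.left, ∃ U : W.left.Opens, w ∈ U ∧
      ∃ f : openSub W U ⟶ Y, R (openIncl W U) f) :
    ∃ f : W ⟶ Y, ∀ {W' : SchemeOver k} (j : W' ⟶ W) (g : W' ⟶ Y), R j g → j ≫ f = g := by
  choose U hU g hg using exists_local
  let 𝒰 : W.left.OpenCover :=
    { I₀ := W.left
      X w := U w
      f w := (U w).ι
      mem₀ := by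
        rw [Scheme.presieve₀_mem_precoverage_iff]
        exact ⟨fun w ↦ ⟨w, by simpa using hU w⟩, inferInstance⟩ }
  have hcompat (x y : W.left) : pullback.fst (U x).ι (U y).ι ≫ (g x).left =
      pullback.snd (U x).ι (U y).ι ≫ (g y).left := by
    let V : SchemeOver k := Over.mk (pullback.fst (U x).ι (U y).ι ≫ (U x).ι ≫ W.hom)
    let a : V ⟶ openSub W (U x) := Over.homMk (pullback.fst (U x).ι (U y).ι)
    let b : V ⟶ openSub W (U y) := Over.homMk (pullback.snd (U x).ι (U y).ι) <| by
      change pullback.snd (U x).ι (U y).ι ≫ (U y).ι ≫ W.hom = _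
      rw [← pullback.condition_assoc]
      rfl
    have hab : a ≫ openIncl W (U x) = b ≫ openIncl W (U y) := by
      ext1
      exact pullback.condition
    have h : a ≫ g x = b ≫ g y :=
      unique _ _ _ (restrict a _ _ (hg x)) (hab ▸ restrict b _ _ (hg y))
    exact congr($(h).left)
  let f : W ⟶ Y := Over.homMk (𝒰.glueMorphisms (fun w ↦ (g w).left) hcompat) <| by
    refine 𝒰.hom_ext _ _ fun w ↦ ?_
    exact (𝒰.ι_glueMorphisms_assoc (fun w ↦ (g w).left) hcompat w Y.hom).trans (Over.w (g w))
  have hf (w : W.left) : openIncl W (U w) ≫ f = g w := by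
    ext1
    exact 𝒰.ι_glueMorphisms (fun w ↦ (g w).left) hcompat w
  refine ⟨f, fun {W'} j h hR ↦ hom_ext_local _ _ fun w ↦ ?_⟩
  obtain ⟨a, ha⟩ := exists_preimage_comp_openIncl j (U (j.left w))
  refine ⟨j.left ⁻¹ᵁ U (j.left w), hU (j.left w), ?_⟩
  rw [← reassoc_of% ha, hf]
  refine unique _ _ _ ?_ (restrict _ _ _ hR)
  rw [← ha]
  exact restrict a _ _ (hg _)

/-- A square is cartesian if it is so on points with values in every `k`-scheme. -/
lemma isPullback_of_points {S E B X : SchemeOver k} (f : E ⟶ B) (p : S ⟶ E) (q : S ⟶ X) (g : X ⟶ B)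
    (w : p ≫ f = q ≫ g)
    (h : ∀ {W : SchemeOver k} (e : W ⟶ E) (x : W ⟶ X), e ≫ f = x ≫ g →
      ∃! s : W ⟶ S, s ≫ p = e ∧ s ≫ q = x) :
    IsPullback p q f g := by
  refine ⟨⟨w⟩, ⟨PullbackCone.IsLimit.mk _
    (fun s ↦ (h s.fst s.snd s.condition).choose)
    (fun s ↦ (h s.fst s.snd s.condition).choose_spec.1.1)
    (fun s ↦ (h s.fst s.snd s.condition).choose_spec.1.2)
    (fun s m h₁ h₂ ↦ (h s.fst s.snd s.condition).choose_spec.2 m ⟨h₁, h₂⟩)⟩⟩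

section LocallyTrivial

variable {X Y F : SchemeOver k} {ρ : Y ⟶ X} {U : X.left.Opens} {ψ : openSub X U ⊗ F ⟶ Y}

lemma lift_comp_comp (h : IsPullback ψ (fst (openSub X U) F) ρ (openIncl X U))
    {W : SchemeOver k} (u : W ⟶ openSub X U) (z : W ⟶ F) :
    (lift u z ≫ ψ) ≫ ρ = u ≫ openIncl X U := by
  rw [Category.assoc, h.w, lift_fst_assoc]

lemma exists_lift_comp_eq (h : IsPullback ψ (fst (openSub X U) F) ρ (openIncl X U))
    {W : SchemeOver k} (y : W ⟶ Y) (u : W ⟶ openSub X U) (w : y ≫ ρ = u ≫ openIncl X U) :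
    ∃ z : W ⟶ F, lift u z ≫ ψ = y := by
  refine ⟨h.lift y u w ≫ snd _ _, ?_⟩
  have : lift u (h.lift y u w ≫ snd _ _) = h.lift y u w := by
    ext1 <;> simp
  rw [this, h.lift_fst]

lemma lift_comp_injective (h : IsPullback ψ (fst (openSub X U) F) ρ (openIncl X U))
    {W : SchemeOver k} {u : W ⟶ openSub X U} {z z' : W ⟶ F}
    (hz : lift u z ≫ ψ = lift u z' ≫ ψ) : z = z' := by
  have := h.hom_ext hz (by simp)
  simpa using congr($this ≫ snd _ _)

end LocallyTrivial

/-! ### Principal bundles in terms of points -/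

/-- The local section of a `T`-scheme over `X` given by the unit section of a trivialisation. -/
noncomputable def unitSection {X P : SchemeOver k} {U : X.left.Opens}
    (φ : openSub X U ⊗ torus k M ⟶ P) : openSub X U ⟶ P :=
  lift (𝟙 _) 1 ≫ φ

lemma comp_unitSection {X P : SchemeOver k} {U : X.left.Opens}
    (φ : openSub X U ⊗ torus k M ⟶ P) {W : SchemeOver k} (u : W ⟶ openSub X U) :
    u ≫ unitSection φ = lift u 1 ≫ φ := by
  rw [unitSection, comp_lift_assoc, Category.comp_id, MonObj.comp_one]

section Trivialization

variable {X P : SchemeOver k} [ModObj (torus k M) P] {π : P ⟶ X} {U : X.left.Opens}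
  {φ : openSub X U ⊗ torus k M ⟶ P}

lemma IsTorusTrivialization.lift_comp (h : IsTorusTrivialization π U φ) {W : SchemeOver k}
    (u : W ⟶ openSub X U) (t : W ⟶ torus k M) : lift u t ≫ φ = t • (lift u 1 ≫ φ) := by
  rw [← h.equivariant, mul_one]

lemma IsTorusTrivialization.smul_injective (h : IsTorusTrivialization π U φ) {W : SchemeOver k}
    (p : W ⟶ P) (u : W ⟶ openSub X U) (w : p ≫ π = u ≫ openIncl X U) {t t' : W ⟶ torus k M}
    (ht : t • p = t' • p) : t = t' := by
  obtain ⟨s, rfl⟩ := exists_lift_comp_eq h.isPullback p u w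
  rw [← h.equivariant, ← h.equivariant] at ht
  exact mul_right_cancel (lift_comp_injective h.isPullback ht)

lemma IsTorusTrivialization.unitSection_comp (h : IsTorusTrivialization π U φ) :
    unitSection φ ≫ π = openIncl X U := by
  rw [unitSection, lift_comp_comp h.isPullback, Category.id_comp]

lemma IsTorusTrivialization.lift_comp_eq_smul (h : IsTorusTrivialization π U φ)
    {W : SchemeOver k} (u : W ⟶ openSub X U) (t : W ⟶ torus k M) :
    lift u t ≫ φ = t • (u ≫ unitSection φ) := by
  rw [h.lift_comp, comp_unitSection]

end Trivialization

section Principal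

variable {X P : SchemeOver k} [ModObj (torus k M) P] {π : P ⟶ X}

/-- The torus acts freely on the points of a principal bundle. -/
lemma IsPrincipalBundle.smul_injective (h : IsPrincipalBundle M π) {W : SchemeOver k}
    (p : W ⟶ P) {t t' : W ⟶ torus k M} (ht : t • p = t' • p) : t = t' := by
  refine hom_ext_local _ _ fun w ↦ ?_
  obtain ⟨U, hU, φ, hφ⟩ := h.locally_trivial ((p ≫ π).left w)
  obtain ⟨u, hu⟩ := exists_preimage_comp_openIncl (p ≫ π) U
  refine ⟨(p ≫ π).left ⁻¹ᵁ U, hU,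
    hφ.smul_injective (openIncl _ _ ≫ p) u (by rw [Category.assoc, hu]) ?_⟩
  rw [← ModObj.comp_smul, ht, ModObj.comp_smul]

/-- The torus acts transitively on the points in a fibre of a principal bundle. -/
lemma IsPrincipalBundle.exists_smul_eq (h : IsPrincipalBundle M π) {W : SchemeOver k}
    (p p' : W ⟶ P) (hp : p ≫ π = p' ≫ π) : ∃ t : W ⟶ torus k M, t • p = p' := by
  have hloc (w : W.left) : ∃ V : W.left.Opens, w ∈ V ∧
      ∃ t : openSub W V ⟶ torus k M, t • (openIncl W V ≫ p) = openIncl W V ≫ p' := by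
    obtain ⟨U, hU, φ, hφ⟩ := h.locally_trivial ((p ≫ π).left w)
    obtain ⟨u, hu⟩ := exists_preimage_comp_openIncl (p ≫ π) U
    refine ⟨(p ≫ π).left ⁻¹ᵁ U, hU, ?_⟩
    obtain ⟨t, ht⟩ := exists_lift_comp_eq hφ.isPullback (openIncl _ _ ≫ p) u
      (by rw [Category.assoc, hu])
    obtain ⟨t', ht'⟩ := exists_lift_comp_eq hφ.isPullback (openIncl _ _ ≫ p') u
      (by rw [Category.assoc, hu, hp])
    exact ⟨t' * t⁻¹, by rw [← ht, ← ht', ← hφ.equivariant, inv_mul_cancel_right]⟩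
  obtain ⟨t, ht⟩ := exists_glue (fun j t ↦ t • (j ≫ p) = j ≫ p')
    (fun a j t ht ↦ by
      rw [Category.assoc, ← ModObj.comp_smul, ht, Category.assoc])
    (fun j t t' ht ht' ↦ h.smul_injective (j ≫ p) (ht.trans ht'.symm)) hloc
  refine ⟨t, hom_ext_local _ _ fun w ↦ ?_⟩
  obtain ⟨V, hV, t', ht'⟩ := hloc w
  exact ⟨V, hV, by rw [ModObj.comp_smul, ht _ _ ht', ht']⟩

lemma IsPrincipalBundle.exists_section (h : IsPrincipalBundle M π) (x : X.left) :
    ∃ U : X.left.Opens, x ∈ U ∧ ∃ s : openSub X U ⟶ P, s ≫ π = openIncl X U := by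
  obtain ⟨U, hU, φ, hφ⟩ := h.locally_trivial x
  exact ⟨U, hU, unitSection φ, hφ.unitSection_comp⟩

/-- If the torus acts simply transitively on the points of the fibres, then every local section
gives a trivialisation. -/
lemma isTorusTrivialization_of_section
    (invariant : ∀ {W : SchemeOver k} (t : W ⟶ torus k M) (p : W ⟶ P), (t • p) ≫ π = p ≫ π)
    (free : ∀ {W : SchemeOver k} (p : W ⟶ P) (t t' : W ⟶ torus k M), t • p = t' • p → t = t')
    (transitive : ∀ {W : SchemeOver k} (p p' : W ⟶ P), p ≫ π = p' ≫ π →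
      ∃ t : W ⟶ torus k M, t • p = p')
    {U : X.left.Opens} (s : openSub X U ⟶ P) (hs : s ≫ π = openIncl X U) :
    IsTorusTrivialization π U
      (snd (openSub X U) (torus k M) • (fst (openSub X U) (torus k M) ≫ s)) := by
  have hcomp {W : SchemeOver k} (w : W ⟶ openSub X U ⊗ torus k M) :
      w ≫ (snd (openSub X U) (torus k M) • (fst (openSub X U) (torus k M) ≫ s)) =
        (w ≫ snd _ _) • ((w ≫ fst _ _) ≫ s) := by
    rw [ModObj.comp_smul, Category.assoc]
  refine ⟨isPullback_of_points _ _ _ _ ?_ fun {W} p u hp ↦ ?_, fun u t t' ↦ ?_⟩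
  · rw [invariant, Category.assoc, hs]
  · obtain ⟨t, ht⟩ := transitive (u ≫ s) p (by rw [Category.assoc, hs, hp])
    refine ⟨lift u t, ⟨by rw [hcomp, lift_fst, lift_snd, ht], lift_fst _ _⟩, ?_⟩
    rintro w ⟨rfl, rfl⟩
    ext1
    · simp
    · rw [lift_snd]
      rw [hcomp] at ht
      exact (free _ _ _ ht).symm
  · rw [hcomp, hcomp, lift_fst, lift_snd, lift_fst, lift_snd, mul_smul]

/-- A scheme on which the torus acts simply transitively on the points of the fibres is a
principal bundle as soon as it has local sections. -/
lemma IsPrincipalBundle.of_simply_transitive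
    (invariant : ∀ {W : SchemeOver k} (t : W ⟶ torus k M) (p : W ⟶ P), (t • p) ≫ π = p ≫ π)
    (free : ∀ {W : SchemeOver k} (p : W ⟶ P) (t t' : W ⟶ torus k M), t • p = t' • p → t = t')
    (transitive : ∀ {W : SchemeOver k} (p p' : W ⟶ P), p ≫ π = p' ≫ π →
      ∃ t : W ⟶ torus k M, t • p = p')
    (exists_section : ∀ x : X.left, ∃ U : X.left.Opens, x ∈ U ∧
      ∃ s : openSub X U ⟶ P, s ≫ π = openIncl X U) : IsPrincipalBundle M π := by
  refine ⟨invariant, fun x ↦ ?_⟩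
  obtain ⟨U, hU, s, hs⟩ := exists_section x
  exact ⟨U, hU, _, isTorusTrivialization_of_section invariant free transitive s hs⟩

end Principal

/-! ### Scheme-theoretic density of the torus -/

lemma isPullback_whiskerLeft (S : SchemeOver k) {A B : SchemeOver k} (f : A ⟶ B) :
    IsPullback (snd S A) (S ◁ f) f (snd S B) := by
  refine isPullback_of_points _ _ _ _ (by simp) fun {W} a b hab ↦ ?_
  refine ⟨lift (b ≫ fst _ _) a, ⟨by simp, ?_⟩, ?_⟩
  · ext1
    · simp
    · simp [hab]
  · rintro s ⟨rfl, rfl⟩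
    ext1 <;> simp

instance flat_snd_left (S B : SchemeOver k) : Flat (snd S B).left :=
  inferInstanceAs (Flat (pullback.snd S.hom B.hom))

instance nonempty_torus : Nonempty (torus k M).left :=
  inferInstanceAs (Nonempty (Spec (CommRingCat.of (AddMonoidAlgebra k M))))

instance quasiCompact_torus_hom : QuasiCompact (torus k M).hom := by
  have : CompactSpace (torus k M).left :=
    inferInstanceAs (CompactSpace (Spec (CommRingCat.of (AddMonoidAlgebra k M))))
  infer_instance

namespace ToricVariety

variable (Z : ToricVariety k M)

attribute [instance] isIntegral isSeparated isOpenImmersion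

instance mono_emb : Mono Z.emb := mono_of_isOpenImmersion _

instance quasiCompact_emb_left : QuasiCompact Z.emb.left := by
  have : QuasiCompact (Z.emb.left ≫ Z.carrier.hom) := by
    rw [Over.w]
    infer_instance
  exact .of_comp _ Z.carrier.hom

instance isDominant_emb_left : IsDominant Z.emb.left where
  denseRange := Z.emb.left.isOpenEmbedding.isOpen_range.dense (Set.range_nonempty _)

/-- `S × T` is scheme-theoretically dense in `S × Z`, as a flat base change of the dense open
subscheme `T` of the integral scheme `Z`. -/
instance isSchemeTheoreticallyDominant_whiskerLeft_emb (S : SchemeOver k) :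
    IsSchemeTheoreticallyDominant (S ◁ Z.emb).left := by
  have : IsSchemeTheoreticallyDominant Z.emb.left := .of_isDominant _
  have h : IsPullback (snd S (torus k M)).left (S ◁ Z.emb).left Z.emb.left
      (snd S Z.carrier).left := (isPullback_whiskerLeft S Z.emb).map (Over.forget _)
  exact .of_isPullback h

end ToricVariety

/-- Morphisms over `k` into a separated scheme which agree after composition with a
scheme-theoretically dominant morphism are equal. -/
lemma hom_ext_of_isSchemeTheoreticallyDominant {A B Y : SchemeOver k} [IsSeparated Y.hom]
    (e : A ⟶ B) [IsSchemeTheoreticallyDominant e.left] {f g : B ⟶ Y} (h : e ≫ f = e ≫ g) :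
    f = g := by
  have hker : (equalizer.ι f g).left.ker = ⊥ := by
    rw [eq_bot_iff, ← Scheme.Hom.ker_eq_bot e.left, ← equalizer.lift_ι e h, Over.comp_left]
    exact Scheme.Hom.le_ker_comp _ _
  have : IsIso (equalizer.ι f g).left := IsClosedImmersion.isIso_iff_ker_eq_bot.mpr hker
  have : IsIso ((Over.forget _).map (equalizer.ι f g)) := this
  have : IsIso (equalizer.ι f g) := isIso_of_reflects_iso (equalizer.ι f g) (Over.forget _)
  exact eq_of_epi_equalizer

/-! ### The mixing bundle from local charts -/

lemma mixingAction_smul {P F W : SchemeOver k} [ModObj (torus k M) P] [ModObj (torus k M) F]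
    (t : W ⟶ torus k M) (w : W ⟶ P ⊗ F) :
    letI : ModObj (torus k M) (P ⊗ F) := mixingAction P F
    t • w = lift (t⁻¹ • (w ≫ fst P F)) (t • (w ≫ snd P F)) := by
  let : ModObj (torus k M) (P ⊗ F) := mixingAction P F
  refine (comp_mixingFormula (lift t w)).trans ?_
  simp

section Mixing

variable {Z : ToricVariety k M} {X P Y : SchemeOver k} [ModObj (torus k M) P] {π : P ⟶ X}
  {ρ : Y ⟶ X}

/-- Relative to local sections of a principal bundle, a point of the bundle is locally given by
its coordinate in the torus. -/
lemma IsPrincipalBundle.exists_local_coordinate (hπ : IsPrincipalBundle M π) {I : Type*}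
    (U : I → X.left.Opens) (hU : ∀ x, ∃ i, x ∈ U i) (s : ∀ i, openSub X (U i) ⟶ P)
    (hs : ∀ i, s i ≫ π = openIncl X (U i)) {W : SchemeOver k} (p : W ⟶ P) (w : W.left) :
    ∃ V : W.left.Opens, w ∈ V ∧ ∃ (i : I) (x : openSub W V ⟶ openSub X (U i))
      (t : openSub W V ⟶ torus k M), t • (x ≫ s i) = openIncl W V ≫ p := by
  obtain ⟨i, hi⟩ := hU ((p ≫ π).left w)
  obtain ⟨x, hx⟩ := exists_preimage_comp_openIncl (p ≫ π) (U i)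
  obtain ⟨t, ht⟩ := hπ.exists_smul_eq (x ≫ s i) (openIncl _ _ ≫ p)
    (by rw [Category.assoc, hs, hx, Category.assoc])
  exact ⟨(p ≫ π).left ⁻¹ᵁ U i, hi, i, x, t, ht⟩

/-- Let `s i` be local sections of a principal bundle `π : P ⟶ X`, and let `ψ i` be local
identifications of `ρ : Y ⟶ X` with the products `U i × Z` whose transition functions are
given by the differences of the sections. Then `Y` is the mixing bundle of `P`, with quotient map
`(t • s i x, z) ↦ ψ i (x, t • z)`. -/
theorem exists_isMixingBundle (hπ : IsPrincipalBundle M π) {I : Type*}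
    (U : I → X.left.Opens) (hU : ∀ x, ∃ i, x ∈ U i) (s : ∀ i, openSub X (U i) ⟶ P)
    (hs : ∀ i, s i ≫ π = openIncl X (U i)) (ψ : ∀ i, openSub X (U i) ⊗ Z.carrier ⟶ Y)
    (hψ : ∀ i, IsPullback (ψ i) (fst (openSub X (U i)) Z.carrier) ρ (openIncl X (U i)))
    (transition : ∀ {W : SchemeOver k} (i j : I) (x : W ⟶ openSub X (U i))
      (y : W ⟶ openSub X (U j)) (t : W ⟶ torus k M) (z : W ⟶ Z.carrier),
      t • (y ≫ s j) = x ≫ s i → lift x z ≫ ψ i = lift y (t • z) ≫ ψ j) :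
    ∃ q : P ⊗ Z.carrier ⟶ Y, IsMixingBundle Z π ρ q ∧
      ∀ {W : SchemeOver k} (i : I) (x : W ⟶ openSub X (U i)) (t : W ⟶ torus k M)
        (z : W ⟶ Z.carrier), lift (t • (x ≫ s i)) z ≫ q = lift x (t • z) ≫ ψ i := by
  -- The graph of `q` relates the points `(t • s i x, z)` and `ψ i (x, t • z)`.
  obtain ⟨q, hq⟩ := exists_glue (W := P ⊗ Z.carrier) (Y := Y)
    (fun {W} j f ↦ ∃ (i : I) (x : W ⟶ openSub X (U i)) (t : W ⟶ torus k M),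
      t • (x ≫ s i) = j ≫ fst _ _ ∧ f = lift x (t • (j ≫ snd _ _)) ≫ ψ i)
    (by
      rintro W W' a j _ ⟨i, x, t, ht, rfl⟩
      refine ⟨i, a ≫ x, a ≫ t, ?_, ?_⟩
      · rw [Category.assoc, Category.assoc, ← ht, ModObj.comp_smul]
      · rw [comp_lift_assoc, ModObj.comp_smul, Category.assoc])
    (by
      rintro W j _ _ ⟨i, x, t, ht, rfl⟩ ⟨i', x', t', ht', rfl⟩
      rw [transition i i' x x' (t⁻¹ * t'), smul_smul, mul_right_comm, inv_mul_cancel, one_mul]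
      rw [mul_smul, ht', ← ht, inv_smul_smul])
    (fun w ↦ by
      obtain ⟨V, hV, i, x, t, ht⟩ := hπ.exists_local_coordinate U hU s hs (fst P Z.carrier) w
      exact ⟨V, hV, _, i, x, t, ht, rfl⟩)
  have hq' {W : SchemeOver k} (i : I) (x : W ⟶ openSub X (U i)) (t : W ⟶ torus k M)
      (z : W ⟶ Z.carrier) : lift (t • (x ≫ s i)) z ≫ q = lift x (t • z) ≫ ψ i :=
    hq _ _ ⟨i, x, t, by rw [lift_fst], by rw [lift_snd]⟩
  have over_base {W : SchemeOver k} (w : W ⟶ P ⊗ Z.carrier) :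
      w ≫ q ≫ ρ = w ≫ fst P Z.carrier ≫ π := by
    refine hom_ext_local _ _ fun v ↦ ?_
    obtain ⟨V, hV, i, x, t, ht⟩ :=
      hπ.exists_local_coordinate U hU s hs (w ≫ fst P Z.carrier) v
    refine ⟨V, hV, ?_⟩
    have hw : openIncl W V ≫ w =
        lift (t • (x ≫ s i)) (openIncl W V ≫ w ≫ snd P Z.carrier) := by
      rw [ht]
      ext1 <;> simp
    have hπw : openIncl W V ≫ w ≫ fst P Z.carrier ≫ π = (t • (x ≫ s i)) ≫ π := by
      rw [ht]
      simp only [Category.assoc]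
    rw [reassoc_of% hw, hπw, ← Category.assoc, hq', lift_comp_comp (hψ i),
      hπ.invariant, Category.assoc, hs]
  refine ⟨q, ⟨by simpa using over_base (𝟙 _), ?_⟩, hq'⟩
  let : ModObj (torus k M) (P ⊗ Z.carrier) := mixingAction P Z.carrier
  refine .of_simply_transitive ?_ ?_ ?_ ?_
  · intro W t w
    refine hom_ext_local _ _ fun v ↦ ?_
    obtain ⟨V, hV, i, x, r, hr⟩ :=
      hπ.exists_local_coordinate U hU s hs (w ≫ fst P Z.carrier) v
    refine ⟨V, hV, ?_⟩
    have hw : openIncl W V ≫ w =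
        lift (r • (x ≫ s i)) (openIncl W V ≫ w ≫ snd P Z.carrier) := by
      rw [hr]
      ext1 <;> simp
    have hw' : openIncl W V ≫ (t • w) = lift (((openIncl W V ≫ t)⁻¹ * r) • (x ≫ s i))
        ((openIncl W V ≫ t) • (openIncl W V ≫ w ≫ snd P Z.carrier)) := by
      rw [mixingAction_smul, comp_lift, ModObj.comp_smul, ModObj.comp_smul, ← hr, GrpObj.comp_inv,
        mul_smul]
    rw [reassoc_of% hw, reassoc_of% hw', hq', hq', smul_smul, mul_right_comm, inv_mul_cancel,
      one_mul]
  · intro W w t t' ht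
    rw [mixingAction_smul, mixingAction_smul] at ht
    have := congr($ht ≫ fst _ _)
    rw [lift_fst, lift_fst] at this
    exact inv_injective (hπ.smul_injective _ this)
  · intro W w w' hw
    obtain ⟨r, hr⟩ := hπ.exists_smul_eq (w ≫ fst _ _) (w' ≫ fst _ _) <| by
      rw [Category.assoc, Category.assoc, ← over_base, ← over_base, ← Category.assoc, hw,
        Category.assoc]
    refine ⟨r⁻¹, ?_⟩
    -- In the same chart, the two points of `P × Z` have torus coordinates `t` and `r * t`.
    have key : w ≫ snd P Z.carrier = r • (w' ≫ snd P Z.carrier) := by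
      refine hom_ext_local _ _ fun v ↦ ?_
      obtain ⟨V, hV, i, x, t, ht⟩ :=
        hπ.exists_local_coordinate U hU s hs (w ≫ fst P Z.carrier) v
      refine ⟨V, hV, ?_⟩
      have h₁ : openIncl W V ≫ w =
          lift (t • (x ≫ s i)) (openIncl W V ≫ w ≫ snd P Z.carrier) := by
        rw [ht]
        ext1 <;> simp
      have h₂ : openIncl W V ≫ w' = lift (((openIncl W V ≫ r) * t) • (x ≫ s i))
          (openIncl W V ≫ w' ≫ snd P Z.carrier) := by
        rw [mul_smul, ht, ← ModObj.comp_smul, hr]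
        ext1 <;> simp
      have h₃ : openIncl W V ≫ w ≫ q = openIncl W V ≫ w' ≫ q := by rw [hw]
      rw [reassoc_of% h₁, reassoc_of% h₂, hq', hq', mul_comm, mul_smul] at h₃
      rw [ModObj.comp_smul]
      exact smul_left_cancel t (lift_comp_injective (hψ i) h₃)
    rw [mixingAction_smul, inv_inv, hr, key, inv_smul_smul]
    ext1 <;> simp
  · intro y
    obtain ⟨i, hi⟩ := hU (ρ.left y)
    obtain ⟨u, hu⟩ := exists_preimage_comp_openIncl ρ (U i)
    obtain ⟨z, hz⟩ := exists_lift_comp_eq (hψ i) (openIncl Y _) u hu.symm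
    refine ⟨ρ.left ⁻¹ᵁ U i, hi, lift (u ≫ s i) z, ?_⟩
    simpa [hz] using hq' i u 1 z

end Mixing

/-! ### Toric variety bundles are mixing bundles -/

/-- Two morphisms from `W × Z` into a scheme which is locally a product with fibre `Z` are equal
if they lie over the same morphism `W ⟶ U` and agree on `W × T`: they amount to two morphisms
into the separated scheme `Z`, and `W × T` is scheme-theoretically dense in `W × Z`. -/
lemma hom_ext_of_whiskerLeft_emb {Z : ToricVariety k M} {X Y : SchemeOver k} {ρ : Y ⟶ X}
    {U : X.left.Opens} {ψ : openSub X U ⊗ Z.carrier ⟶ Y}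
    (hψ : IsPullback ψ (fst (openSub X U) Z.carrier) ρ (openIncl X U)) {W : SchemeOver k}
    (u : W ⟶ openSub X U) {f g : W ⊗ Z.carrier ⟶ Y}
    (hf : f ≫ ρ = fst _ _ ≫ u ≫ openIncl X U) (hg : g ≫ ρ = fst _ _ ≫ u ≫ openIncl X U)
    (h : (W ◁ Z.emb) ≫ f = (W ◁ Z.emb) ≫ g) : f = g := by
  obtain ⟨a, rfl⟩ := exists_lift_comp_eq hψ f (fst W Z.carrier ≫ u) (by simpa using hf)
  obtain ⟨b, rfl⟩ := exists_lift_comp_eq hψ g (fst W Z.carrier ≫ u) (by simpa using hg)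
  have : a = b := by
    refine hom_ext_of_isSchemeTheoreticallyDominant (W ◁ Z.emb) ?_
    refine lift_comp_injective hψ (u := fst W (torus k M) ≫ u) ?_
    simpa [comp_lift_assoc] using h
  rw [this]

section BundleTrivialization

variable {Z : ToricVariety k M} {X P Y : SchemeOver k} [ModObj (torus k M) P] {π : P ⟶ X}
  {ρ : Y ⟶ X} {i : P ⟶ Y}

lemma IsBundleTrivialization.lift_emb_comp {U : X.left.Opens}
    {φ : openSub X U ⊗ torus k M ⟶ P} {ψ : openSub X U ⊗ Z.carrier ⟶ Y}
    (h : IsBundleTrivialization Z π ρ i U φ ψ) {W : SchemeOver k} (x : W ⟶ openSub X U)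
    (t : W ⟶ torus k M) : lift x (t ≫ Z.emb) ≫ ψ = (t • (x ≫ unitSection φ)) ≫ i := by
  rw [← h.torus_part.lift_comp_eq_smul, Category.assoc, h.compatible, lift_whiskerLeft_assoc]

/-- The transition functions of a toric variety bundle are given by the torus: they are the
differences of the unit sections. Both sides of the asserted equation are morphisms into the
separated scheme `Z` over an open subset of `X`, and they agree where `z` lies in the torus. -/
theorem IsBundleTrivialization.lift_comp_eq {U V : X.left.Opens}
    {φ : openSub X U ⊗ torus k M ⟶ P} {ψ : openSub X U ⊗ Z.carrier ⟶ Y}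
    {φ' : openSub X V ⊗ torus k M ⟶ P} {ψ' : openSub X V ⊗ Z.carrier ⟶ Y}
    (h : IsBundleTrivialization Z π ρ i U φ ψ) (h' : IsBundleTrivialization Z π ρ i V φ' ψ')
    (invariant : ∀ {W : SchemeOver k} (t : W ⟶ torus k M) (p : W ⟶ P), (t • p) ≫ π = p ≫ π)
    {W : SchemeOver k} (x : W ⟶ openSub X U) (x' : W ⟶ openSub X V) (t : W ⟶ torus k M)
    (z : W ⟶ Z.carrier) (ht : t • (x' ≫ unitSection φ') = x ≫ unitSection φ) :
    lift x z ≫ ψ = lift x' (t • z) ≫ ψ' := by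
  have hx : x ≫ openIncl X U = x' ≫ openIncl X V := by
    have := congr($ht ≫ π)
    rw [invariant, Category.assoc, Category.assoc, h.torus_part.unitSection_comp,
      h'.torus_part.unitSection_comp] at this
    exact this.symm
  have key : lift (fst W Z.carrier ≫ x) (snd W Z.carrier) ≫ ψ =
      lift (fst W Z.carrier ≫ x') ((fst W Z.carrier ≫ t) • snd W Z.carrier) ≫ ψ' := by
    refine hom_ext_of_whiskerLeft_emb h.isPullback x ?_ ?_ ?_
    · rw [lift_comp_comp h.isPullback, Category.assoc]
    · rw [lift_comp_comp h'.isPullback, Category.assoc, hx]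
    have hz : (W ◁ Z.emb) ≫ ((fst W Z.carrier ≫ t) • snd W Z.carrier) =
        ((fst W (torus k M) ≫ t) * snd W (torus k M)) ≫ Z.emb := by
      simp [ModObj.comp_smul, Z.emb_mul]
    rw [comp_lift_assoc, comp_lift_assoc, hz, whiskerLeft_fst_assoc, whiskerLeft_fst_assoc,
      whiskerLeft_snd, h.lift_emb_comp, h'.lift_emb_comp, Category.assoc, ← ht,
      ModObj.comp_smul, smul_smul, mul_comm, Category.assoc]
  have := congr(lift (𝟙 W) z ≫ $key)
  simpa [comp_lift_assoc, ModObj.comp_smul] using this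

/-- The action of the torus on itself is the multiplication. -/
lemma regular_smul {W : SchemeOver k} (s t : W ⟶ torus k M) :
    letI : ModObj (torus k M) (torus k M) := ModObj.regular _
    s • t = s * t :=
  rfl

/-- The transition functions of a toric variety bundle factor through the torus. -/
theorem IsToricVarietyBundle.exists_isTransitionFunction (h : IsToricVarietyBundle Z π ρ i)
    {U V : X.left.Opens} {φ : openSub X U ⊗ torus k M ⟶ P} {ψ : openSub X U ⊗ Z.carrier ⟶ Y}
    {φ' : openSub X V ⊗ torus k M ⟶ P} {ψ' : openSub X V ⊗ Z.carrier ⟶ Y}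
    (hU : IsBundleTrivialization Z π ρ i U φ ψ) (hV : IsBundleTrivialization Z π ρ i V φ' ψ') :
    ∃ g : openSub X (U ⊓ V) ⟶ torus k M,
      (letI : ModObj (torus k M) (torus k M) := ModObj.regular _
       IsTransitionFunction U V φ φ' g) ∧
      IsTransitionFunction U V ψ ψ' g ∧
      ∀ g' : openSub X (U ⊓ V) ⟶ torus k M, IsTransitionFunction U V ψ ψ' g' → g' = g := by
  obtain ⟨g, hg⟩ := h.principal.exists_smul_eq (openMono X inf_le_left ≫ unitSection φ)
    (openMono X inf_le_right ≫ unitSection φ') (by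
      simp [hU.torus_part.unitSection_comp, hV.torus_part.unitSection_comp])
  have hg' {W : SchemeOver k} (x : W ⟶ openSub X (U ⊓ V)) :
      (x ≫ g) • ((x ≫ openMono X inf_le_left) ≫ unitSection φ) =
        (x ≫ openMono X inf_le_right) ≫ unitSection φ' := by
    rw [Category.assoc, Category.assoc, ← hg, ModObj.comp_smul]
  have hψ : IsTransitionFunction U V ψ ψ' g := fun x z ↦
    (hV.lift_comp_eq hU h.principal.invariant _ _ _ z (hg' x)).symm
  refine ⟨g, fun x t ↦ ?_, hψ, fun g' hg' ↦ ?_⟩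
  · rw [regular_smul, hU.torus_part.lift_comp_eq_smul, hV.torus_part.lift_comp_eq_smul, mul_comm,
      mul_smul, hg']
  -- Evaluated at the unit of the torus inside `Z`, the transition function recovers `g'`.
  · have := (hg' (𝟙 _) ((1 : _ ⟶ torus k M) ≫ Z.emb)).trans
      (hψ (𝟙 _) ((1 : _ ⟶ torus k M) ≫ Z.emb)).symm
    have := lift_comp_injective hU.isPullback this
    rw [← Z.emb_mul, ← Z.emb_mul, cancel_mono] at this
    simpa using this

/-- A morphism `q` over the base which is compatible with a toric variety bundle `i` is determined
by `i`: it is prescribed on `P × T`, which is scheme-theoretically dense in `P × Z`. -/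
lemma IsToricVarietyBundle.eq_of_isCompatible (h : IsToricVarietyBundle Z π ρ i)
    {q q' : P ⊗ Z.carrier ⟶ Y} (hq : q ≫ ρ = fst _ _ ≫ π) (hq' : q' ≫ ρ = fst _ _ ≫ π)
    (hi : IsCompatible Z i q) (hi' : IsCompatible Z i q') : q = q' := by
  -- The points of `P × Z` over a fixed point `p` of `P` are those of `W × Z`.
  have key {U : X.left.Opens} {ψ : openSub X U ⊗ Z.carrier ⟶ Y}
      (hψ : IsPullback ψ (fst (openSub X U) Z.carrier) ρ (openIncl X U)) {W : SchemeOver k}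
      (p : W ⟶ P) (x : W ⟶ openSub X U) (hx : x ≫ openIncl X U = p ≫ π) :
      p ▷ Z.carrier ≫ q = p ▷ Z.carrier ≫ q' := by
    refine hom_ext_of_whiskerLeft_emb hψ x ?_ ?_ ?_
    · rw [Category.assoc, hq, whiskerRight_fst_assoc, hx]
    · rw [Category.assoc, hq', whiskerRight_fst_assoc, hx]
    have hp : (W ◁ Z.emb) ≫ p ▷ Z.carrier = lift (fst _ _ ≫ p) (snd _ _ ≫ Z.emb) := by
      ext1 <;> simp
    rw [reassoc_of% hp, reassoc_of% hp, hi, hi']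
  refine hom_ext_local _ _ fun w ↦ ?_
  obtain ⟨U, hU, φ, ψ, hφψ⟩ := h.locally_trivial ((fst P Z.carrier ≫ π).left w)
  refine ⟨(fst P Z.carrier ≫ π).left ⁻¹ᵁ U, hU, ?_⟩
  obtain ⟨x, hx⟩ := exists_preimage_comp_openIncl (fst P Z.carrier ≫ π) U
  generalize openIncl (P ⊗ Z.carrier) ((fst P Z.carrier ≫ π).left ⁻¹ᵁ U) = j at hx ⊢
  have hj : lift (𝟙 _) (j ≫ snd P Z.carrier) ≫ (j ≫ fst P Z.carrier) ▷ Z.carrier = j := by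
    rw [lift_whiskerRight, Category.id_comp, ← comp_lift, lift_fst_snd, Category.comp_id]
  rw [← hj, Category.assoc, key hφψ.isPullback _ x (by rw [hx, Category.assoc]), Category.assoc]

/-- Every toric variety bundle is a mixing bundle. -/
theorem IsToricVarietyBundle.existsUnique_isMixingBundle (h : IsToricVarietyBundle Z π ρ i) :
    ∃! q : P ⊗ Z.carrier ⟶ Y, IsMixingBundle Z π ρ q ∧ IsCompatible Z i q := by
  choose U hU φ ψ hφψ using h.locally_trivial
  obtain ⟨q, hq, hqψ⟩ := exists_isMixingBundle h.principal U (fun x ↦ ⟨x, hU x⟩)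
    (fun x ↦ unitSection (φ x)) (fun x ↦ (hφψ x).torus_part.unitSection_comp) ψ
    (fun x ↦ (hφψ x).isPullback)
    (fun x y u v t z ht ↦ (hφψ x).lift_comp_eq (hφψ y) h.principal.invariant u v t z ht)
  have hi : IsCompatible Z i q := fun {W} p t ↦ by
    refine hom_ext_local _ _ fun w ↦ ?_
    obtain ⟨V, hV, x, u, r, hr⟩ := h.principal.exists_local_coordinate U (fun x ↦ ⟨x, hU x⟩)
      (fun x ↦ unitSection (φ x)) (fun x ↦ (hφψ x).torus_part.unitSection_comp) p w
    refine ⟨V, hV, ?_⟩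
    rw [comp_lift_assoc, ← hr, hqψ, ← Category.assoc, ← Category.assoc, ← Z.emb_mul,
      (hφψ x).lift_emb_comp, ModObj.comp_smul, ← hr, smul_smul, mul_comm]
  exact ⟨q, ⟨hq, hi⟩, fun q' hq' ↦
    h.eq_of_isCompatible hq'.1.over_base hq.over_base hq'.2 hi⟩

end BundleTrivialization

/-! ### Mixing bundles are toric variety bundles -/

namespace IsMixingBundle

variable {Z : ToricVariety k M} {X P Y : SchemeOver k} [ModObj (torus k M) P] {π : P ⟶ X}
  {ρ : Y ⟶ X} {q : P ⊗ Z.carrier ⟶ Y}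

lemma lift_comp_comp (h : IsMixingBundle Z π ρ q) {W : SchemeOver k} (p : W ⟶ P)
    (z : W ⟶ Z.carrier) : (lift p z ≫ q) ≫ ρ = p ≫ π := by
  rw [Category.assoc, h.over_base, lift_fst_assoc]

lemma lift_smul_comp (h : IsMixingBundle Z π ρ q) {W : SchemeOver k} (t : W ⟶ torus k M)
    (p : W ⟶ P) (z : W ⟶ Z.carrier) : lift (t • p) z ≫ q = lift p (t • z) ≫ q := by
  let : ModObj (torus k M) (P ⊗ Z.carrier) := mixingAction P Z.carrier
  have := h.quotient.invariant t (lift (t • p) z)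
  rw [mixingAction_smul, lift_fst, lift_snd, inv_smul_smul] at this
  exact this.symm

lemma lift_comp_injective (h : IsMixingBundle Z π ρ q) (hπ : IsPrincipalBundle M π)
    {W : SchemeOver k} {p : W ⟶ P} {z z' : W ⟶ Z.carrier}
    (hz : lift p z ≫ q = lift p z' ≫ q) : z = z' := by
  let : ModObj (torus k M) (P ⊗ Z.carrier) := mixingAction P Z.carrier
  obtain ⟨t, ht⟩ := h.quotient.exists_smul_eq _ _ hz
  rw [mixingAction_smul, lift_fst, lift_snd] at ht
  have h₁ : t⁻¹ • p = (1 : W ⟶ torus k M) • p := by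
    simpa using congr($ht ≫ fst _ _)
  have h₂ : t • z = z' := by
    simpa using congr($ht ≫ snd _ _)
  rw [← h₂, inv_eq_one.mp (hπ.smul_injective p h₁), one_smul]

/-- The fibre of a mixing bundle over a point `x` of the base is identified with `Z` by any point
of the principal bundle over `x`. -/
lemma exists_lift_comp_eq (h : IsMixingBundle Z π ρ q) (hπ : IsPrincipalBundle M π)
    {W : SchemeOver k} (p : W ⟶ P) (y : W ⟶ Y) (hp : y ≫ ρ = p ≫ π) :
    ∃ z : W ⟶ Z.carrier, lift p z ≫ q = y := by
  let : ModObj (torus k M) (P ⊗ Z.carrier) := mixingAction P Z.carrier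
  have hloc (w : W.left) : ∃ V : W.left.Opens, w ∈ V ∧
      ∃ z : openSub W V ⟶ Z.carrier, lift (openIncl W V ≫ p) z ≫ q = openIncl W V ≫ y := by
    obtain ⟨V, hV, s, hs⟩ := h.quotient.exists_section (y.left w)
    obtain ⟨v, hv⟩ := exists_preimage_comp_openIncl y V
    refine ⟨y.left ⁻¹ᵁ V, hV, ?_⟩
    have hvs : lift (v ≫ s ≫ fst _ _) (v ≫ s ≫ snd _ _) ≫ q = openIncl W _ ≫ y := by
      rw [← comp_lift, ← comp_lift, lift_fst_snd, Category.comp_id, Category.assoc, hs, hv]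
    obtain ⟨r, hr⟩ := hπ.exists_smul_eq (v ≫ s ≫ fst _ _) (openIncl W _ ≫ p) <| by
      rw [← h.lift_comp_comp _ (v ≫ s ≫ snd _ _), hvs, Category.assoc, hp, Category.assoc]
    exact ⟨r⁻¹ • (v ≫ s ≫ snd _ _), by rw [← hr, h.lift_smul_comp, smul_inv_smul, hvs]⟩
  obtain ⟨z, hz⟩ := exists_glue (fun j z ↦ lift (j ≫ p) z ≫ q = j ≫ y)
    (fun a j z hz ↦ by rw [Category.assoc, ← comp_lift_assoc, hz, Category.assoc])
    (fun j z z' hz hz' ↦ h.lift_comp_injective hπ (hz.trans hz'.symm)) hloc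
  refine ⟨z, hom_ext_local _ _ fun w ↦ ?_⟩
  obtain ⟨V, hV, z', hz'⟩ := hloc w
  exact ⟨V, hV, by rw [comp_lift_assoc, hz _ _ hz', hz']⟩

/-- A local section `s` of the principal bundle identifies the mixing bundle locally with the
product with fibre `Z`, by `(x, z) ↦ q (s x, z)`. -/
lemma isPullback_whiskerRight_comp (h : IsMixingBundle Z π ρ q) (hπ : IsPrincipalBundle M π)
    {U : X.left.Opens} (s : openSub X U ⟶ P) (hs : s ≫ π = openIncl X U) :
    IsPullback (s ▷ Z.carrier ≫ q) (fst (openSub X U) Z.carrier) ρ (openIncl X U) := by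
  refine isPullback_of_points _ _ _ _ ?_ fun {W} y x hy ↦ ?_
  · rw [Category.assoc, h.over_base, whiskerRight_fst_assoc, hs]
  · obtain ⟨z, hz⟩ := h.exists_lift_comp_eq hπ (x ≫ s) y (by rw [hy, Category.assoc, hs])
    refine ⟨lift x z, ⟨by rw [lift_whiskerRight_assoc, hz], lift_fst _ _⟩, ?_⟩
    rintro w ⟨hw, rfl⟩
    ext1
    · rw [lift_fst]
    · rw [lift_snd]
      refine h.lift_comp_injective hπ (p := (w ≫ fst _ _) ≫ s) ?_
      rw [hz, ← hw, ← lift_whiskerRight_assoc, ← comp_lift, lift_fst_snd, Category.comp_id]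

/-- Every mixing bundle is a toric variety bundle; the inclusion of the principal bundle is
`p ↦ q (p, 1)`. -/
theorem existsUnique_isToricVarietyBundle (h : IsMixingBundle Z π ρ q)
    (hπ : IsPrincipalBundle M π) :
    ∃! i : P ⟶ Y, IsToricVarietyBundle Z π ρ i ∧ IsCompatible Z i q := by
  let i : P ⟶ Y := lift (𝟙 P) ((1 : P ⟶ torus k M) ≫ Z.emb) ≫ q
  have hi : IsCompatible Z i q := fun {W} p t ↦ by
    have : t ≫ Z.emb = t • ((1 : W ⟶ torus k M) ≫ Z.emb) := by
      rw [← Z.emb_mul, mul_one]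
    rw [this, ← h.lift_smul_comp, comp_lift_assoc, Category.comp_id, ← Category.assoc,
      MonObj.comp_one]
  refine ⟨i, ⟨⟨hπ, ?_, fun x ↦ ?_⟩, hi⟩, fun i' hi' ↦ ?_⟩
  · rw [h.lift_comp_comp, Category.id_comp]
  · obtain ⟨U, hU, φ, hφ⟩ := hπ.locally_trivial x
    refine ⟨U, hU, φ, unitSection φ ▷ Z.carrier ≫ q, hφ,
      h.isPullback_whiskerRight_comp hπ _ hφ.unitSection_comp, ?_⟩
    have h₁ : φ = snd (openSub X U) (torus k M) • (fst (openSub X U) (torus k M) ≫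
        unitSection φ) := by
      rw [← hφ.lift_comp_eq_smul, lift_fst_snd, Category.id_comp]
    have h₂ : (openSub X U ◁ Z.emb) ≫ unitSection φ ▷ Z.carrier =
        lift (fst _ _ ≫ unitSection φ) (snd _ _ ≫ Z.emb) := by
      ext1 <;> simp
    rw [reassoc_of% h₂, hi, ← h₁]
  · have := hi'.2 (𝟙 P) 1
    rwa [one_smul, Category.id_comp, eq_comm] at this

end IsMixingBundle

/-! ### Existence of the mixing bundle -/

/-- A section of `π : P ⟶ X` over an open subset of `X`. -/
structure LocalSection {X P : SchemeOver k} (π : P ⟶ X) : Type u where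
  /-- the open subset over which the section is defined -/
  opens : X.left.Opens
  /-- the section -/
  hom : openSub X opens ⟶ P
  hom_comp : hom ≫ π = openIncl X opens

/-- The restriction of a local section to a smaller open subset. -/
noncomputable def LocalSection.restrict {X P : SchemeOver k} {π : P ⟶ X} (σ : LocalSection π)
    {U : X.left.Opens} (h : U ≤ σ.opens) : LocalSection π where
  opens := U
  hom := openMono X h ≫ σ.hom
  hom_comp := by rw [Category.assoc, σ.hom_comp, openMono_openIncl]

/-- Local sections are ordered by inclusion of their domains; the sections themselves are not
required to restrict to each other. -/
noncomputable instance {X P : SchemeOver k} (π : P ⟶ X) : Preorder (LocalSection π) :=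
  Preorder.lift LocalSection.opens

lemma LocalSection.le_def {X P : SchemeOver k} {π : P ⟶ X} {σ τ : LocalSection π} :
    σ ≤ τ ↔ σ.opens ≤ τ.opens :=
  Iff.rfl

lemma LocalSection.restrict_le {X P : SchemeOver k} {π : P ⟶ X} (σ : LocalSection π)
    {U : X.left.Opens} (h : U ≤ σ.opens) : σ.restrict h ≤ σ :=
  h

/-- The intersection of two open subschemes surjects onto their fibre product. -/
lemma exists_lift_homOfLE_eq {S : Scheme.{u}} (U V : S.Opens) (x : ↥(pullback U.ι V.ι)) :
    ∃ y : ↥(U ⊓ V).toScheme, pullback.lift (S.homOfLE (inf_le_left : U ⊓ V ≤ U))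
      (S.homOfLE (inf_le_right : U ⊓ V ≤ V)) (by simp) y = x := by
  have hx : U.ι (pullback.fst U.ι V.ι x) = V.ι (pullback.snd U.ι V.ι x) := by
    rw [← Scheme.Hom.comp_apply, ← Scheme.Hom.comp_apply, pullback.condition]
  obtain ⟨y, hy⟩ : U.ι (pullback.fst U.ι V.ι x) ∈ Set.range (U ⊓ V).ι := by
    rw [Scheme.Opens.range_ι]
    exact ⟨(pullback.fst U.ι V.ι x).2, hx ▸ (pullback.snd U.ι V.ι x).2⟩
  refine ⟨y, (pullback.fst U.ι V.ι ≫ U.ι).isOpenEmbedding.injective ?_⟩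
  rw [← Scheme.Hom.comp_apply, pullback.lift_fst_assoc, Scheme.homOfLE_ι, hy,
    Scheme.Hom.comp_apply]

namespace IsPrincipalBundle

variable {X P : SchemeOver k} [ModObj (torus k M) P] {π : P ⟶ X}

/-- The cover of the base of a principal bundle by the domains of the local sections. -/
noncomputable def sectionCover (hπ : IsPrincipalBundle M π) : X.left.OpenCover where
  I₀ := LocalSection π
  X σ := σ.opens
  f σ := σ.opens.ι
  mem₀ := by
    rw [Scheme.presieve₀_mem_precoverage_iff]
    refine ⟨fun x ↦ ?_, inferInstance⟩
    obtain ⟨U, hU, s, hs⟩ := hπ.exists_section x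
    exact ⟨⟨U, s, hs⟩, by simpa using hU⟩

noncomputable instance (hπ : IsPrincipalBundle M π) : Preorder hπ.sectionCover.I₀ :=
  inferInstanceAs (Preorder (LocalSection π))

noncomputable instance (hπ : IsPrincipalBundle M π) : hπ.sectionCover.LocallyDirected where
  trans h := X.left.homOfLE (leOfHom h)
  trans_id σ := Scheme.homOfLE_rfl _ _
  trans_comp h h' := (Scheme.homOfLE_homOfLE _ _ _).symm
  w h := Scheme.homOfLE_ι _ _
  directed {σ τ} x := by
    obtain ⟨y, hy⟩ := exists_lift_homOfLE_eq (LocalSection.opens σ) (LocalSection.opens τ) x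
    exact ⟨LocalSection.restrict σ inf_le_left, homOfLE (LocalSection.restrict_le _ _),
      homOfLE (LocalSection.le_def.mpr inf_le_right), y, hy⟩
  property_trans h := inferInstanceAs (IsOpenImmersion (X.left.homOfLE _))

/-- The difference `g` of two local sections, on the smaller of their domains: the point of the
torus with `g • τ = σ`. -/
noncomputable def difference (hπ : IsPrincipalBundle M π) {σ τ : LocalSection π} (h : σ ≤ τ) :
    openSub X σ.opens ⟶ torus k M :=
  (hπ.exists_smul_eq (openMono X h ≫ τ.hom) σ.hom
    (by rw [Category.assoc, τ.hom_comp, openMono_openIncl, σ.hom_comp])).choose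

lemma difference_smul (hπ : IsPrincipalBundle M π) {σ τ : LocalSection π} (h : σ ≤ τ) :
    hπ.difference h • (openMono X h ≫ τ.hom) = σ.hom :=
  (hπ.exists_smul_eq (openMono X h ≫ τ.hom) σ.hom
    (by rw [Category.assoc, τ.hom_comp, openMono_openIncl, σ.hom_comp])).choose_spec

lemma comp_difference (hπ : IsPrincipalBundle M π) {σ τ : LocalSection π} (h : σ ≤ τ)
    {W : SchemeOver k} (x : W ⟶ openSub X σ.opens) (y : W ⟶ openSub X τ.opens)
    (hxy : x ≫ openMono X h = y) (t : W ⟶ torus k M) (ht : t • (y ≫ τ.hom) = x ≫ σ.hom) :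
    x ≫ hπ.difference h = t := by
  refine hπ.smul_injective (y ≫ τ.hom) ?_
  rw [ht, ← hπ.difference_smul h, ModObj.comp_smul, reassoc_of% hxy]

variable (F : SchemeOver k) [ModObj (torus k M) F]

/-- The transition map `(x, z) ↦ (x, g x • z)` between the local pieces `U × F` of the mixing
bundle, where `g` is the difference of the local sections. -/
noncomputable def transition (hπ : IsPrincipalBundle M π) {σ τ : LocalSection π} (h : σ ≤ τ) :
    openSub X σ.opens ⊗ F ⟶ openSub X τ.opens ⊗ F :=
  lift (fst _ _ ≫ openMono X h)
    ((fst (openSub X σ.opens) F ≫ hπ.difference h) • snd (openSub X σ.opens) F)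

variable {F} in
lemma lift_transition (hπ : IsPrincipalBundle M π) {σ τ : LocalSection π} (h : σ ≤ τ)
    {W : SchemeOver k} (x : W ⟶ openSub X σ.opens) (z : W ⟶ F) :
    lift x z ≫ hπ.transition F h = lift (x ≫ openMono X h) ((x ≫ hπ.difference h) • z) := by
  rw [transition, comp_lift, ModObj.comp_smul, lift_fst_assoc, lift_fst_assoc, lift_snd]

lemma isPullback_transition (hπ : IsPrincipalBundle M π) {σ τ : LocalSection π} (h : σ ≤ τ) :
    IsPullback (hπ.transition F h) (fst (openSub X σ.opens) F) (fst (openSub X τ.opens) F)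
      (openMono X h) := by
  refine isPullback_of_points _ _ _ _ (by rw [transition, lift_fst]) fun {W} w x hx ↦ ?_
  refine ⟨lift x ((x ≫ hπ.difference h)⁻¹ • (w ≫ snd _ _)), ⟨?_, lift_fst _ _⟩, ?_⟩
  · rw [lift_transition, smul_inv_smul, ← hx, ← comp_lift, lift_fst_snd, Category.comp_id]
  · rintro v ⟨rfl, rfl⟩
    ext1
    · rw [lift_fst]
    · rw [lift_snd, Category.assoc v (hπ.transition F h), transition, lift_snd, ModObj.comp_smul,
        ← Category.assoc v, inv_smul_smul]

/-- The diagram of the local pieces `U × F` of the mixing bundle. -/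
noncomputable def mixingDiagram (hπ : IsPrincipalBundle M π) : LocalSection π ⥤ SchemeOver k where
  obj σ := openSub X σ.opens ⊗ F
  map h := hπ.transition F (leOfHom h)
  map_id σ := by
    have h : fst _ _ ≫ hπ.difference (le_refl σ) = (1 : openSub X σ.opens ⊗ F ⟶ torus k M) :=
      hπ.comp_difference _ _ (fst _ _) (by rw [openMono_refl, Category.comp_id]) 1 (one_smul _ _)
    rw [transition, h, one_smul, openMono_refl, Category.comp_id, lift_fst_snd]
  map_comp {σ τ υ} f g := by
    -- The cocycle condition.
    have h : fst (openSub X σ.opens) F ≫ hπ.difference (leOfHom (f ≫ g)) =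
        (fst _ _ ≫ openMono X (leOfHom f) ≫ hπ.difference (leOfHom g)) *
          (fst _ _ ≫ hπ.difference (leOfHom f)) := by
      refine hπ.comp_difference _ _ (fst _ _ ≫ openMono X (leOfHom f) ≫ openMono X (leOfHom g))
        (by simp) _ ?_
      conv_rhs => rw [← hπ.difference_smul (leOfHom f), ModObj.comp_smul,
        ← hπ.difference_smul (leOfHom g)]
      rw [mul_comm, mul_smul, ModObj.comp_smul, ModObj.comp_smul]
      simp [reassoc_of% (openMono_openMono X (leOfHom f) (leOfHom g))]
    have h' := hπ.lift_transition (leOfHom g) (fst (openSub X σ.opens) F ≫ openMono X (leOfHom f))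
      ((fst (openSub X σ.opens) F ≫ hπ.difference (leOfHom f)) • snd (openSub X σ.opens) F)
    rw [transition, h]
    refine Eq.trans ?_ h'.symm
    rw [smul_smul]
    simp

/-- The mixing diagram as a gluing datum relative to the cover of the base by the domains of the
local sections. -/
noncomputable def mixingGluingData (hπ : IsPrincipalBundle M π) :
    hπ.sectionCover.RelativeGluingData where
  functor := hπ.mixingDiagram F ⋙ Over.forget _
  natTrans :=
    { app σ := (fst (openSub X (LocalSection.opens σ)) F).left
      naturality σ τ f := by
        exact congr(($((hπ.isPullback_transition F (leOfHom f)).w)).left) }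
  equifibered σ τ f := (hπ.isPullback_transition F (leOfHom f)).map (Over.forget _)

/-- The gluing of the local pieces `U × F`, as a scheme over `k`. -/
noncomputable def mixing (hπ : IsPrincipalBundle M π) : SchemeOver k :=
  Over.mk ((hπ.mixingGluingData F).toBase ≫ X.hom)

/-- The structure morphism of the glued scheme. -/
noncomputable def mixingToBase (hπ : IsPrincipalBundle M π) : hπ.mixing F ⟶ X :=
  Over.homMk (hπ.mixingGluingData F).toBase

/-- The chart of the glued scheme given by a local section. -/
noncomputable def mixingChart (hπ : IsPrincipalBundle M π) (σ : LocalSection π) :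
    openSub X σ.opens ⊗ F ⟶ hπ.mixing F :=
  Over.homMk (colimit.ι (hπ.mixingGluingData F).functor σ) <| by
    have h : colimit.ι (hπ.mixingGluingData F).functor σ ≫ (hπ.mixingGluingData F).toBase =
        (fst (openSub X σ.opens) F ≫ openIncl X σ.opens).left :=
      (hπ.mixingGluingData F).ι_toBase σ
    change colimit.ι (hπ.mixingGluingData F).functor σ ≫ (hπ.mixingGluingData F).toBase ≫ X.hom = _
    rw [reassoc_of% h]
    exact Over.w _

lemma isPullback_mixingChart (hπ : IsPrincipalBundle M π) (σ : LocalSection π) :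
    IsPullback (hπ.mixingChart F σ) (fst (openSub X σ.opens) F) (hπ.mixingToBase F)
      (openIncl X σ.opens) := by
  have := ((hπ.mixingGluingData F).isPullback_natTrans_ι_toBase σ).flip
  have h : IsPullback (hπ.mixingChart F σ).left (fst (openSub X σ.opens) F).left
    (hπ.mixingToBase F).left (openIncl X σ.opens).left := this
  exact IsPullback.of_map (Over.forget _) (by ext1; exact h.w) h

lemma transition_mixingChart (hπ : IsPrincipalBundle M π) {σ τ : LocalSection π} (h : σ ≤ τ) :
    hπ.transition F h ≫ hπ.mixingChart F τ = hπ.mixingChart F σ := by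
  ext1
  exact colimit.w (hπ.mixingGluingData F).functor (homOfLE h)

lemma lift_mixingChart_of_le (hπ : IsPrincipalBundle M π) {σ τ : LocalSection π} (h : σ ≤ τ)
    {W : SchemeOver k} (x : W ⟶ openSub X σ.opens) (y : W ⟶ openSub X τ.opens)
    (hxy : x ≫ openMono X h = y) (t : W ⟶ torus k M) (z : W ⟶ F)
    (ht : t • (y ≫ τ.hom) = x ≫ σ.hom) :
    lift x z ≫ hπ.mixingChart F σ = lift y (t • z) ≫ hπ.mixingChart F τ := by
  rw [← hπ.transition_mixingChart F h, ← Category.assoc, lift_transition,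
    hπ.comp_difference h x y hxy t ht, hxy]

/-- The charts of the glued scheme differ by the differences of the local sections. It suffices
to compare both with the chart of a local section over the intersection. -/
lemma lift_mixingChart (hπ : IsPrincipalBundle M π) (σ τ : LocalSection π)
    {W : SchemeOver k} (x : W ⟶ openSub X σ.opens) (y : W ⟶ openSub X τ.opens)
    (t : W ⟶ torus k M) (z : W ⟶ F) (ht : t • (y ≫ τ.hom) = x ≫ σ.hom) :
    lift x z ≫ hπ.mixingChart F σ = lift y (t • z) ≫ hπ.mixingChart F τ := by
  have hxy : x ≫ openIncl X σ.opens = y ≫ openIncl X τ.opens := by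
    have := congr($ht ≫ π)
    rw [hπ.invariant, Category.assoc, Category.assoc, σ.hom_comp, τ.hom_comp] at this
    exact this.symm
  obtain ⟨κ, hσ, hτ, w, hx, hκ⟩ : ∃ (κ : LocalSection π) (hσ : κ ≤ σ) (_ : κ ≤ τ)
      (w : W ⟶ openSub X κ.opens), w ≫ openMono X hσ = x ∧ w ≫ κ.hom = x ≫ σ.hom := by
    obtain ⟨w, hw⟩ := exists_comp_openIncl (x ≫ openIncl X σ.opens) (σ.opens ⊓ τ.opens)
      fun v ↦ ⟨comp_openIncl_mem x v, hxy ▸ comp_openIncl_mem y v⟩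
    have hx : w ≫ openMono X inf_le_left = x := by
      rw [← cancel_mono (openIncl X _), Category.assoc, openMono_openIncl, hw]
    exact ⟨σ.restrict inf_le_left, σ.restrict_le _, LocalSection.le_def.mpr inf_le_right, w, hx,
      by rw [← hx, Category.assoc]; rfl⟩
  have hy : w ≫ openMono X hτ = y := by
    rw [← cancel_mono (openIncl X _), Category.assoc, openMono_openIncl, ← hxy, ← hx,
      Category.assoc, openMono_openIncl]
  have h₁ := hπ.lift_mixingChart_of_le F hσ w x hx 1 z (by rw [one_smul, hκ])
  rw [one_smul] at h₁
  rw [← h₁, hπ.lift_mixingChart_of_le F hτ w y hy t z (by rw [ht, hκ])]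

end IsPrincipalBundle

/-- The mixing bundle of a principal bundle exists. -/
theorem IsPrincipalBundle.exists_mixingBundle {X P : SchemeOver k} [ModObj (torus k M) P]
    {π : P ⟶ X} (hπ : IsPrincipalBundle M π) (Z : ToricVariety k M) :
    ∃ (Y : SchemeOver k) (ρ : Y ⟶ X) (q : P ⊗ Z.carrier ⟶ Y), IsMixingBundle Z π ρ q := by
  obtain ⟨q, hq, -⟩ := exists_isMixingBundle hπ LocalSection.opens
    (fun x ↦ by
      obtain ⟨U, hU, s, hs⟩ := hπ.exists_section x
      exact ⟨⟨U, s, hs⟩, hU⟩)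
    LocalSection.hom LocalSection.hom_comp (hπ.mixingChart Z.carrier)
    (hπ.isPullback_mixingChart Z.carrier)
    (fun σ τ x y t z ht ↦ hπ.lift_mixingChart Z.carrier σ τ x y t z ht)
  exact ⟨_, _, q, hq⟩

end ToricBundle

theorem mainTheorem6 {k : Type u} [Field k]
    {M : Type u} [AddCommGroup M] [Module.Free ℤ M] [Module.Finite ℤ M]
    (Z : ToricBundle.ToricVariety k M) (X : ToricBundle.SchemeOver k) :
    -- the mixing bundle of a principal bundle exists as a scheme over `X`
    (∀ (P : ToricBundle.SchemeOver k) [ModObj (ToricBundle.torus k M) P] (π : P ⟶ X),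
      ToricBundle.IsPrincipalBundle M π →
        ∃ (Y : ToricBundle.SchemeOver k) (ρ : Y ⟶ X) (q : P ⊗ Z.carrier ⟶ Y),
          ToricBundle.IsMixingBundle Z π ρ q) ∧
    -- a mixing bundle is a toric variety bundle
    (∀ (P Y : ToricBundle.SchemeOver k) [ModObj (ToricBundle.torus k M) P] (π : P ⟶ X)
      (ρ : Y ⟶ X) (q : P ⊗ Z.carrier ⟶ Y),
      ToricBundle.IsPrincipalBundle M π → ToricBundle.IsMixingBundle Z π ρ q →
        ∃! i : P ⟶ Y, ToricBundle.IsToricVarietyBundle Z π ρ i ∧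
          ToricBundle.IsCompatible Z i q) ∧
    -- a toric variety bundle is a mixing bundle
    (∀ (P Y : ToricBundle.SchemeOver k) [ModObj (ToricBundle.torus k M) P] (π : P ⟶ X)
      (ρ : Y ⟶ X) (i : P ⟶ Y),
      ToricBundle.IsToricVarietyBundle Z π ρ i →
        ∃! q : P ⊗ Z.carrier ⟶ Y, ToricBundle.IsMixingBundle Z π ρ q ∧
          ToricBundle.IsCompatible Z i q) ∧
    -- the transition functions of a toric variety bundle factor through the torus
    (∀ (P Y : ToricBundle.SchemeOver k) [ModObj (ToricBundle.torus k M) P] (π : P ⟶ X)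
      (ρ : Y ⟶ X) (i : P ⟶ Y),
      ToricBundle.IsToricVarietyBundle Z π ρ i →
        ∀ (U V : X.left.Opens)
          (φ : ToricBundle.openSub X U ⊗ ToricBundle.torus k M ⟶ P)
          (ψ : ToricBundle.openSub X U ⊗ Z.carrier ⟶ Y)
          (φ' : ToricBundle.openSub X V ⊗ ToricBundle.torus k M ⟶ P)
          (ψ' : ToricBundle.openSub X V ⊗ Z.carrier ⟶ Y),
          ToricBundle.IsBundleTrivialization Z π ρ i U φ ψ →
          ToricBundle.IsBundleTrivialization Z π ρ i V φ' ψ' →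
            ∃ g : ToricBundle.openSub X (U ⊓ V) ⟶ ToricBundle.torus k M,
              (letI : ModObj (ToricBundle.torus k M) (ToricBundle.torus k M) := ModObj.regular _
               ToricBundle.IsTransitionFunction U V φ φ' g) ∧
              ToricBundle.IsTransitionFunction U V ψ ψ' g ∧
              ∀ g' : ToricBundle.openSub X (U ⊓ V) ⟶ ToricBundle.torus k M,
                ToricBundle.IsTransitionFunction U V ψ ψ' g' → g' = g) := by
  refine ⟨fun P _ π hπ ↦ hπ.exists_mixingBundle Z,
    fun P Y _ π ρ q hπ hq ↦ hq.existsUnique_isToricVarietyBundle hπ,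
    fun P Y _ π ρ i hi ↦ hi.existsUnique_isMixingBundle,
    fun P Y _ π ρ i hi U V φ ψ φ' ψ' hU hV ↦ hi.exists_isTransitionFunction hU hV⟩
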